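/- Let $d\ge 1$ and $1\le\alpha<2$. Let $M:\mathbb R^d\to\mathbb R$ be twice differentiable with $M>0$, $M(-v)=M(v)$, $\int_{\mathbb R^d} M\,dv=1$, $|v|^{d+\alpha}M(v)\to\gamma$ as $|v|\to\infty$ for some $\gamma>0$, and $|D_vM(v)|\le C\frac{M(v)}{1+|v|}$, $|D_v^2M(v)|\le C\,M(v)$ for all $v$. Let $\sigma:\mathbb R^d\times\mathbb R^d\to\mathbb R$ satisfy, for some constants $0<\nu_1\le\nu_2$, $\nu_0$ and $C$ and all $v,v'\in\mathbb R^d$: $\sigma(v,v')=\sigma(v',v)$; $\nu_1\le\sigma(v,v')\le\nu_2$; $\sigma(v',\cdot)$ is differentiable with $|\nabla_v\sigma(v',v)|\le\frac{C}{1+|v|}$; $|\sigma(v,v')-\nu_0|\le\frac{C}{1+|v|}$; and the collision frequency $\nu(v)=\int\sigma(v',v)M(v')\,dv'$ is even. Set $$Q(f)(v)=\int_{\mathbb R^d}\big(\sigma(v,v')M(v)f(v')-\sigma(v',v)M(v')f(v)\big)\,dv'.$$ For a positive weight $w$, let $L^2_{w^{-1}}$ be the space of measurable $f$ with $\|f\|^2_{L^2_{w^{-1}}}=\int|f|^2\,\frac{dv}{w}<\infty$.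 For $E\in\mathbb R^d$ let $$T(f)=-Q(f)+E\cdot\nabla_v f,\qquad D(T)=\{f\in L^2_{M^{-1}}: E\cdot\nabla_v f\in L^2_{M^{-1}}\},$$ where $E\cdot\nabla_v f$ is taken in the sense of distributions, and let $F=F(\cdot,E)$ denote the positive solution in $L^2_{M^{-1}}$ of $$E\cdot\nabla_vF-Q(F)=0\ \text{ (in the sense of distributions)},\qquad \int_{\mathbb R^d}F\,dv=1$$ (the claims below hold for every such solution). Write $\rho_f=\int f\,dv$. Then, for all $E\in\mathbb R^d$ and all $f\in D(T)$, the function $T(f)\,f/F$ is integrable and $$\int_{\mathbb R^d}T(f)(v)\,\frac{f(v)}{F(v,E)}\,dv\ \ge\ 0.$$ Furthermore, for all $R>0$ there exists a constant $\theta(R)>0$ (which may depend on $d,\alpha,M,\sigma$ but not on $E$ or $f$) such that for all $|E|\le R$ and all $f\in D(T)$, the functions $f$ and $f-\rho_fF$ belong to $L^2_{F^{-1}}$ and $$\int_{\mathbb R^d}T(f)(v)\,\frac{f(v)}{F(v,E)}\,dv\ \ge\ \theta(R)\,\|f-\rho_fF\|^2_{L^2_{F^{-1}}(\mathbb R^d)}.$$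 -/

import Mathlib

open MeasureTheory Filter Topology Bornology
open scoped ContDiff

namespace LinearBoltzmann

/-- The velocity space `ℝ^d` with its Euclidean structure and Lebesgue measure `volume`. -/
abbrev Vel (d : ℕ) : Type := EuclideanSpace ℝ (Fin d)

variable {d : ℕ}

/-! ### Data of the linear Boltzmann operator -/

/-- The collision frequency `ν(v) = ∫ σ(v', v) M(v') dv'`. -/
noncomputable def collisionFrequency (M : Vel d → ℝ) (σ : Vel d → Vel d → ℝ) (v : Vel d) : ℝ :=
  ∫ v', σ v' v * M v'

/-- The assumptions on the thermodynamical equilibrium `M`: positive, even, normalized, with a heavy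
tail of order `d + α`, `1 ≤ α < 2`, and with decaying first and second derivatives. -/
structure IsHeavyTailed (α : ℝ) (M : Vel d → ℝ) : Prop where
  one_le : 1 ≤ α
  lt_two : α < 2
  pos : ∀ v, 0 < M v
  even : ∀ v, M (-v) = M v
  integral_eq_one : ∫ v, M v = 1
  tail : ∃ γ : ℝ, 0 < γ ∧ Tendsto (fun v => ‖v‖ ^ ((d : ℝ) + α) * M v) (cobounded (Vel d)) (𝓝 γ)
  differentiable : Differentiable ℝ M
  differentiable_fderiv : Differentiable ℝ (fderiv ℝ M)
  norm_fderiv_le : ∃ C : ℝ, ∀ v, ‖fderiv ℝ M v‖ ≤ C * (M v / (1 + ‖v‖))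
  norm_fderiv_fderiv_le : ∃ C : ℝ, ∀ v, ‖fderiv ℝ (fderiv ℝ M) v‖ ≤ C * M v

/-- The assumptions on the cross section `σ`: symmetric, bounded above and below by positive
constants, with decaying gradient in one velocity, even collision frequency, and a limit `ν₀` as
`|v| → ∞` with rate `1 / (1 + |v|)`. -/
structure IsCrossSection (M : Vel d → ℝ) (σ : Vel d → Vel d → ℝ) : Prop where
  symm : ∀ v v', σ v v' = σ v' v
  bounds : ∃ ν₁ ν₂ : ℝ, 0 < ν₁ ∧ ∀ v v', ν₁ ≤ σ v v' ∧ σ v v' ≤ ν₂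
  differentiable : ∀ v', Differentiable ℝ (fun v => σ v' v)
  norm_fderiv_le : ∃ C : ℝ, ∀ v' v, ‖fderiv ℝ (fun w => σ v' w) v‖ ≤ C / (1 + ‖v‖)
  even_frequency : ∀ v, collisionFrequency M σ (-v) = collisionFrequency M σ v
  limit : ∃ ν₀ C : ℝ, ∀ v v', |σ v v' - ν₀| ≤ C / (1 + ‖v‖)

/-- The linear Boltzmann operator
`Q(f)(v) = ∫ (σ(v, v') M(v) f(v') - σ(v', v) M(v') f(v)) dv'`. -/
noncomputable def collision (M : Vel d → ℝ) (σ : Vel d → Vel d → ℝ) (f : Vel d → ℝ)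
    (v : Vel d) : ℝ :=
  ∫ v', (σ v v' * M v * f v' - σ v' v * M v' * f v)

/-! ### Weighted spaces, mass density and weak derivatives -/

/-- `f` belongs to `L²_{w⁻¹}(ℝ^d)`, that is, `f` is measurable and `∫ |f|² / w dv < ∞`. -/
def MemL2Inv (w f : Vel d → ℝ) : Prop :=
  AEStronglyMeasurable f volume ∧ Integrable (fun v => |f v| ^ 2 / w v) volume

/-- The norm of `L²_{w⁻¹}(ℝ^d)`. -/
noncomputable def normL2Inv (w f : Vel d → ℝ) : ℝ :=
  Real.sqrt (∫ v, |f v| ^ 2 / w v)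

/-- The mass density `ρ_f = ∫ f dv`. -/
noncomputable def massDensity (f : Vel d → ℝ) : ℝ := ∫ v, f v

/-- `g = E · ∇_v f` in the sense of distributions on `ℝ^d`. -/
def HasWeakDirDeriv (E : Vel d) (f g : Vel d → ℝ) : Prop :=
  LocallyIntegrable f volume ∧ LocallyIntegrable g volume ∧
    ∀ φ : Vel d → ℝ, ContDiff ℝ ∞ φ → HasCompactSupport φ →
      ∫ v, f v * fderiv ℝ φ v E = - ∫ v, g v * φ v

open Classical in
/-- The function `E · ∇_v f` (unique up to null sets), when the distribution `E · ∇_v f` is a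
locally integrable function; `0` otherwise. -/
noncomputable def weakDirDeriv (E : Vel d) (f : Vel d → ℝ) : Vel d → ℝ :=
  if h : ∃ g, HasWeakDirDeriv E f g then h.choose else 0

/-! ### The operator `T` and the modified equilibrium `F` -/

/-- The operator `T(f) = -Q(f) + E · ∇_v f`. -/
noncomputable def transportCollision (M : Vel d → ℝ) (σ : Vel d → Vel d → ℝ) (E : Vel d)
    (f : Vel d → ℝ) (v : Vel d) : ℝ :=
  - collision M σ f v + weakDirDeriv E f v

/-- The domain of the unbounded operator `T`: those `f ∈ L²_{M⁻¹}` whose distributional derivative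
`E · ∇_v f` is again (a function) in `L²_{M⁻¹}`. -/
def InDomain (M : Vel d → ℝ) (E : Vel d) (f : Vel d → ℝ) : Prop :=
  MemL2Inv M f ∧ ∃ g, HasWeakDirDeriv E f g ∧ MemL2Inv M g

/-- `F = F(·, E)` is the modified equilibrium: the positive solution in `L²_{M⁻¹}` of
`E · ∇_v F - Q(F) = 0`, `∫ F dv = 1`. -/
structure IsModifiedEquilibrium (M : Vel d → ℝ) (σ : Vel d → Vel d → ℝ) (E : Vel d)
    (F : Vel d → ℝ) : Prop where
  memL2 : MemL2Inv M F
  pos : ∀ᵐ v, 0 < F v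
  equation : HasWeakDirDeriv E F (collision M σ F)
  integral_eq_one : ∫ v, F v = 1

end LinearBoltzmann

namespace LinearBoltzmann

variable {d : ℕ}

/-! ### Translations in `L¹` and weak directional derivatives -/

/-! Put `h = f / F`. Formally E·∇f · f/F = ½ (E·∇F) h² + ½ E·∇(F h²), and the last term integrates
to zero. Since E·∇F = Q(F), the transport term contributes ½ ∫ Q(F) h². Adding -∫ Q(f) h and using
the symmetry of σ gives ∫ T(f) f/F = ½ ∬ σ(v,v') M(v) F(v') (h(v) - h(v'))² dv dv' ≥ 0. With σ ≥ ν₁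
and M, F probability densities, expanding the square and using (∫ M h)² ≤ ∫ M h² bounds this below
by ν₁/2 times the variance of h under F dv, which is ‖f - ρ_f F‖² in L²_{F⁻¹}. So θ = ν₁/2 works for
all E.

Two points need care. First, f is only known to lie in L²_{M⁻¹}, so every integrability claim rests
on a bound F ≥ κ M (`IsModifiedEquilibrium.exists_mul_le`), obtained by a Gronwall argument along
the lines v + sE. Here κ may depend on E, since it does not enter θ. Second, f and F have only weak
derivatives along E, so the chain rule for f²/F is replaced by a variational argument on translates
(`integral_truncate_transport_eq_zero`). Both use that weak derivatives in L¹ are derivatives of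
translates against bounded functions. -/

/-- The translate `v ↦ f (v + s • E)` of an integrable function, as an element of `L¹`. -/
noncomputable def translateL1 (E : Vel d) (f : Lp ℝ 1 (volume : Measure (Vel d))) (s : ℝ) :
    Lp ℝ 1 (volume : Measure (Vel d)) :=
  Lp.compMeasurePreserving (fun v => v + s • E) (measurePreserving_add_right volume (s • E)) f

theorem coeFn_translateL1 (E : Vel d) {f : Vel d → ℝ} (hf : Integrable f) (s : ℝ) :
    translateL1 E (hf.toL1 f) s =ᵐ[volume] fun v => f (v + s • E) := by
  have hp := measurePreserving_add_right (volume : Measure (Vel d)) (s • E)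
  exact (Lp.coeFn_compMeasurePreserving _ hp).trans
    (hp.quasiMeasurePreserving.ae_eq_comp hf.coeFn_toL1)

theorem continuous_translateL1 (E : Vel d) (f : Lp ℝ 1 (volume : Measure (Vel d))) :
    Continuous (translateL1 E f) := by
  -- Currying makes s ↦ (v ↦ v + sE) continuous for the compact-open topology, which is what
  -- continuity of composition in L¹ requires.
  let g : C(ℝ, C(Vel d, Vel d)) :=
    (ContinuousMap.mk (fun a : ℝ × Vel d => a.2 + a.1 • E) (by fun_prop)).curry
  exact (continuous_const (y := f)).compMeasurePreservingLp g.continuous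
    (fun s => measurePreserving_add_right volume (s • E)) ENNReal.one_ne_top

/-- Integration against a bounded measurable function, as a continuous linear form on `L¹`. -/
theorem exists_clm_integral_mul {ψ : Vel d → ℝ} (hψ : AEStronglyMeasurable ψ volume) {C : ℝ}
    (hC : ∀ v, |ψ v| ≤ C) :
    ∃ L : Lp ℝ 1 (volume : Measure (Vel d)) →L[ℝ] ℝ, ∀ u, L u = ∫ v, ψ v * u v := by
  have hm : MemLp ψ ⊤ volume :=
    memLp_top_of_bound hψ C (Eventually.of_forall fun v => by simpa using hC v)
  refine ⟨(ContinuousLinearMap.mul ℝ ℝ).lpPairing volume ⊤ 1 (hm.toLp ψ), fun u => ?_⟩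
  rw [ContinuousLinearMap.lpPairing_eq_integral]
  refine integral_congr_ae ?_
  filter_upwards [hm.coeFn_toLp] with v hv
  simp [hv]

theorem integral_mul_translate (E : Vel d) (ψ f : Vel d → ℝ) (s : ℝ) :
    ∫ v, ψ v * f (v + s • E) = ∫ v, ψ (v - s • E) * f v := by
  rw [← integral_add_right_eq_self (fun v => ψ (v - s • E) * f v) (s • E)]
  simp

/-- After a change of variables the translation acts on φ, so the s-derivative falls on φ. The weak
equation tested on the translated φ then moves it to f. -/
theorem hasDerivAt_integral_test_translate {E : Vel d} {f g : Vel d → ℝ} (hf : Integrable f)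
    (h : HasWeakDirDeriv E f g) {φ : Vel d → ℝ} (hφ : ContDiff ℝ ∞ φ)
    (hφc : HasCompactSupport φ) (s : ℝ) :
    HasDerivAt (fun s : ℝ => ∫ v, φ v * f (v + s • E)) (∫ v, φ v * g (v + s • E)) s := by
  simp_rw [integral_mul_translate E φ]
  have hd : Differentiable ℝ φ := hφ.differentiable (by simp)
  have hdc : Continuous (fderiv ℝ φ) := hφ.continuous_fderiv (by simp)
  obtain ⟨C, hC⟩ := (hφc.fderiv (𝕜 := ℝ)).exists_bound_of_continuous hdc
  obtain ⟨B, hB⟩ := hφc.exists_bound_of_continuous hφ.continuous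
  have key := (hasDerivAt_integral_of_dominated_loc_of_deriv_le (μ := (volume : Measure (Vel d)))
    (F := fun (s : ℝ) v => φ (v - s • E) * f v)
    (F' := fun (s : ℝ) v => fderiv ℝ φ (v - s • E) (-E) * f v) (x₀ := s) (s := Set.univ)
    (bound := fun v => C * ‖E‖ * ‖f v‖) univ_mem
    (Eventually.of_forall fun t =>
      ((hφ.continuous.comp (by fun_prop)).aestronglyMeasurable).mul hf.1)
    (hf.bdd_mul ((hφ.continuous.comp (by fun_prop)).aestronglyMeasurable)
      (Eventually.of_forall fun v => hB _))
    ((((hdc.comp (by fun_prop : Continuous fun v : Vel d => v - s • E)).clm_apply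
      continuous_const).aestronglyMeasurable).mul hf.1)
    (Eventually.of_forall fun v t _ => ?_) (hf.norm.const_mul _)
    (Eventually.of_forall fun v t _ => ?_)).2
  · refine HasDerivAt.congr_deriv key ?_
    have hw := h.2.2 (fun v => φ (v - s • E)) (hφ.comp (by fun_prop))
      (hφc.comp_homeomorph (Homeomorph.subRight (s • E)))
    have hfd : ∀ v, fderiv ℝ (fun v => φ (v - s • E)) v = fderiv ℝ φ (v - s • E) := fun v => by
      rw [fderiv_comp_sub]
    simp_rw [hfd] at hw
    simp only [map_neg, neg_mul, integral_neg]
    rw [show (∫ v, fderiv ℝ φ (v - s • E) E * f v) = ∫ v, f v * fderiv ℝ φ (v - s • E) E from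
      integral_congr_ae (Eventually.of_forall fun v => mul_comm _ _), hw, neg_neg]
    exact integral_congr_ae (Eventually.of_forall fun v => mul_comm _ _)
  · rw [norm_mul]
    refine mul_le_mul_of_nonneg_right ?_ (norm_nonneg _)
    refine (ContinuousLinearMap.le_opNorm _ _).trans ?_
    rw [norm_neg]
    exact mul_le_mul_of_nonneg_right (hC _) (norm_nonneg _)
  · have h1 : HasDerivAt (fun t : ℝ => v - t • E) (-E) t := by
      simpa using ((hasDerivAt_id t).smul_const E).const_sub v
    exact ((hd (v - t • E)).hasFDerivAt.comp_hasDerivAt t h1).mul_const (f v)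

/-- Paired with any test function, the difference of the two sides has zero derivative in s and
vanishes at s = 0. An L¹ function orthogonal to all test functions is zero. The identity holds in L¹
itself, so it can afterwards be paired with any bounded measurable function. -/
theorem translateL1_eq_add_integral {E : Vel d} {f g : Vel d → ℝ} (hf : Integrable f)
    (hg : Integrable g) (h : HasWeakDirDeriv E f g) (s : ℝ) :
    translateL1 E (hf.toL1 f) s =
      translateL1 E (hf.toL1 f) 0 + ∫ r in (0 : ℝ)..s, translateL1 E (hg.toL1 g) r := by
  set u := translateL1 E (hf.toL1 f) with hu
  set w := translateL1 E (hg.toL1 g) with hw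
  have hwc : Continuous w := continuous_translateL1 E _
  have hder : ∀ t, HasDerivAt (fun s : ℝ => ∫ r in (0 : ℝ)..s, w r) (w t) t := fun t =>
    intervalIntegral.integral_hasDerivAt_right (hwc.intervalIntegrable _ _)
      (hwc.stronglyMeasurableAtFilter _ _) hwc.continuousAt
  set z : Lp ℝ 1 (volume : Measure (Vel d)) := u s - (u 0 + ∫ r in (0 : ℝ)..s, w r) with hz
  suffices h0 : z = 0 from sub_eq_zero.1 h0
  have hzi : Integrable z := L1.integrable_coeFn z
  have hae : ∀ᵐ v, z v = 0 := by
    refine ae_eq_zero_of_integral_contDiff_smul_eq_zero hzi.locallyIntegrable fun φ hφ hφc => ?_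
    obtain ⟨B, hB⟩ := hφc.exists_bound_of_continuous hφ.continuous
    obtain ⟨L, hL⟩ := exists_clm_integral_mul hφ.continuous.aestronglyMeasurable
      (C := B) (fun v => by simpa using hB v)
    have hLu : ∀ t, L (u t) = ∫ v, φ v * f (v + t • E) := fun t => by
      rw [hL]
      refine integral_congr_ae ?_
      filter_upwards [coeFn_translateL1 E hf t] with v hv
      rw [hu, hv]
    have hLw : ∀ t, L (w t) = ∫ v, φ v * g (v + t • E) := fun t => by
      rw [hL]
      refine integral_congr_ae ?_
      filter_upwards [coeFn_translateL1 E hg t] with v hv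
      rw [hw, hv]
    have hD : ∀ t, HasDerivAt
        (fun t => L (u t) - L (u 0 + ∫ r in (0 : ℝ)..t, w r)) 0 t := fun t => by
      have h1 : HasDerivAt (fun t => L (u t)) (L (w t)) t := by
        simp_rw [hLu, hLw]
        exact hasDerivAt_integral_test_translate hf h hφ hφc t
      have h2 : HasDerivAt (fun t => L (u 0 + ∫ r in (0 : ℝ)..t, w r)) (L (w t)) t :=
        L.hasFDerivAt.comp_hasDerivAt t ((hder t).const_add (u 0))
      exact (h1.sub h2).congr_deriv (sub_self _)
    have hc := is_const_of_deriv_eq_zero (fun t => (hD t).differentiableAt)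
      (fun t => (hD t).deriv) s 0
    simp only [intervalIntegral.integral_same, add_zero, sub_self] at hc
    rw [← map_sub, ← hz, hL] at hc
    simpa using hc
  exact Lp.ext (by
    filter_upwards [hae, Lp.coeFn_zero ℝ 1 (volume : Measure (Vel d))] with v h1 h2
    rw [h1, h2, Pi.zero_apply])

/-- If `E · ∇f = g` weakly with `f`, `g` integrable, then the translates of `f` along `E` are
differentiable against every bounded function. -/
theorem hasDerivAt_integral_mul_translate {E : Vel d} {f g : Vel d → ℝ} (hf : Integrable f)
    (hg : Integrable g) (h : HasWeakDirDeriv E f g) {ψ : Vel d → ℝ}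
    (hψ : AEStronglyMeasurable ψ volume) {C : ℝ} (hC : ∀ v, |ψ v| ≤ C) (s : ℝ) :
    HasDerivAt (fun s : ℝ => ∫ v, ψ v * f (v + s • E)) (∫ v, ψ v * g (v + s • E)) s := by
  obtain ⟨L, hL⟩ := exists_clm_integral_mul hψ hC
  have hLt : ∀ {k : Vel d → ℝ} (hk : Integrable k) (t : ℝ),
      ∫ v, ψ v * k (v + t • E) = L (translateL1 E (hk.toL1 k) t) := fun hk t => by
    rw [hL]
    refine integral_congr_ae ?_
    filter_upwards [coeFn_translateL1 E hk t] with v hv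
    rw [hv]
  rw [hLt hg, funext (hLt hf), funext fun t => congrArg L (translateL1_eq_add_integral hf hg h t)]
  have hwc := continuous_translateL1 E (hg.toL1 g)
  exact L.hasFDerivAt.comp_hasDerivAt s
    ((intervalIntegral.integral_hasDerivAt_right (hwc.intervalIntegrable _ _)
      (hwc.stronglyMeasurableAtFilter _ _) hwc.continuousAt).const_add _)

/-! ### Weighted spaces -/

theorem MemL2Inv.integrable_mul_div {w f g : Vel d → ℝ} (hw : ∀ᵐ v, 0 < w v)
    (hwm : AEStronglyMeasurable w volume) (hf : MemL2Inv w f) (hg : MemL2Inv w g) :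
    Integrable (fun v => f v * g v / w v) := by
  refine (hf.2.add hg.2).mono' (((hf.1.aemeasurable.mul hg.1.aemeasurable).div
    hwm.aemeasurable).aestronglyMeasurable) ?_
  filter_upwards [hw] with v hv
  simp only [Pi.add_apply, Real.norm_eq_abs, abs_div, abs_mul, abs_of_pos hv, ← add_div]
  gcongr
  nlinarith [sq_nonneg (|f v| - |g v|), sq_nonneg (|f v| + |g v|)]

theorem MemL2Inv.integrable {w f : Vel d → ℝ} (hw : ∀ᵐ v, 0 < w v) (hwi : Integrable w)
    (hf : MemL2Inv w f) : Integrable f := by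
  -- Write f = f w / w and pair f with w in the weighted space.
  have hww : MemL2Inv w w := ⟨hwi.1, hwi.congr (by
    filter_upwards [hw] with v hv
    rw [sq_abs]
    field_simp)⟩
  refine (hf.integrable_mul_div hw hwi.1 hww).congr ?_
  filter_upwards [hw] with v hv
  field_simp

theorem MemL2Inv.of_mul_le {w w' f : Vel d → ℝ} {κ : ℝ} (hκ : 0 < κ) (hw : ∀ᵐ v, 0 < w v)
    (hw' : AEStronglyMeasurable w' volume) (hle : ∀ᵐ v, κ * w v ≤ w' v) (hf : MemL2Inv w f) :
    MemL2Inv w' f := by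
  refine ⟨hf.1, (hf.2.const_mul κ⁻¹).mono' ((hf.1.aemeasurable.abs.pow_const 2).div
    hw'.aemeasurable).aestronglyMeasurable ?_⟩
  filter_upwards [hw, hle] with v hv hl
  have hκw : 0 < κ * w v := mul_pos hκ hv
  rw [Real.norm_eq_abs, abs_div, abs_of_pos (hκw.trans_le hl), abs_of_nonneg (by positivity)]
  calc |f v| ^ 2 / w' v ≤ |f v| ^ 2 / (κ * w v) := by gcongr
    _ = κ⁻¹ * (|f v| ^ 2 / w v) := by field_simp

/-! ### The collision operator -/

variable {α : ℝ} {M : Vel d → ℝ} {σ : Vel d → Vel d → ℝ}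

theorem IsHeavyTailed.integrable (hM : IsHeavyTailed α M) : Integrable M := by
  by_contra h
  simpa [integral_undef h] using hM.integral_eq_one

/-- The gain rate `∫ σ(v, v') f(v') dv'`. -/
noncomputable def gainRate (σ : Vel d → Vel d → ℝ) (f : Vel d → ℝ) (v : Vel d) : ℝ :=
  ∫ v', σ v v' * f v'

theorem IsCrossSection.continuous_right (hσ : IsCrossSection M σ) (v : Vel d) :
    Continuous (σ v) :=
  (hσ.differentiable v).continuous

/-- A Carathéodory argument: symmetry carries continuity from the second variable to the first. -/
theorem IsCrossSection.stronglyMeasurable (hσ : IsCrossSection M σ) :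
    StronglyMeasurable (Function.uncurry σ) := by
  refine stronglyMeasurable_uncurry_of_continuous_of_stronglyMeasurable (fun v => ?_)
    fun v => (hσ.continuous_right v).stronglyMeasurable
  simp_rw [fun v' => hσ.symm v' v]
  exact hσ.continuous_right v

theorem IsCrossSection.integrable_mul (hσ : IsCrossSection M σ) {f : Vel d → ℝ}
    (hf : Integrable f) (v : Vel d) : Integrable (fun v' => σ v v' * f v') := by
  obtain ⟨ν₁, ν₂, h0, hb⟩ := hσ.bounds
  refine hf.bdd_mul (c := ν₂) (hσ.continuous_right v).aestronglyMeasurable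
    (Eventually.of_forall fun v' => ?_)
  rw [Real.norm_eq_abs, abs_of_pos (h0.trans_le (hb v v').1)]
  exact (hb v v').2

theorem IsCrossSection.collision_eq (hσ : IsCrossSection M σ) (hM : Integrable M)
    {f : Vel d → ℝ} (hf : Integrable f) (v : Vel d) :
    collision M σ f v = M v * gainRate σ f v - gainRate σ M v * f v := by
  have h1 : ∀ v', σ v v' * M v * f v' - σ v' v * M v' * f v =
      M v * (σ v v' * f v') - (σ v v' * M v') * f v := fun v' => by
    rw [hσ.symm v' v]; ring
  simp only [collision, h1, gainRate]
  rw [integral_sub ((hσ.integrable_mul hf v).const_mul _) ((hσ.integrable_mul hM v).mul_const _),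
    integral_const_mul, integral_mul_const]

theorem IsCrossSection.aestronglyMeasurable_gainRate (hσ : IsCrossSection M σ) {f : Vel d → ℝ}
    (hf : AEStronglyMeasurable f volume) : AEStronglyMeasurable (gainRate σ f) volume := by
  have h : AEStronglyMeasurable (fun p : Vel d × Vel d => Function.uncurry σ p * f p.2)
      (volume.prod volume) := hσ.stronglyMeasurable.aestronglyMeasurable.mul hf.comp_snd
  exact h.integral_prod_right'

theorem IsCrossSection.gainRate_bounds (hσ : IsCrossSection M σ) {ν₁ ν₂ : ℝ}
    (hb : ∀ v v', ν₁ ≤ σ v v' ∧ σ v v' ≤ ν₂) {f : Vel d → ℝ} (hf : ∀ᵐ v, 0 < f v)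
    (hfi : Integrable f) (hf1 : ∫ v, f v = 1) (v : Vel d) :
    ν₁ ≤ gainRate σ f v ∧ gainRate σ f v ≤ ν₂ := by
  have hc : ∀ ν : ℝ, ∫ v', ν * f v' = ν := fun ν => by rw [integral_const_mul, hf1, mul_one]
  constructor
  · rw [← hc ν₁]
    refine integral_mono_ae (hfi.const_mul _) (hσ.integrable_mul hfi v) ?_
    filter_upwards [hf] with v' h
    exact mul_le_mul_of_nonneg_right (hb v v').1 h.le
  · rw [← hc ν₂]
    refine integral_mono_ae (hσ.integrable_mul hfi v) (hfi.const_mul _) ?_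
    filter_upwards [hf] with v' h
    exact mul_le_mul_of_nonneg_right (hb v v').2 h.le

theorem IsModifiedEquilibrium.integrable {E : Vel d} {F : Vel d → ℝ}
    (hF : IsModifiedEquilibrium M σ E F) : Integrable F := by
  by_contra h
  simpa [integral_undef h] using hF.integral_eq_one

theorem IsCrossSection.integrable_collision (hσ : IsCrossSection M σ) (hM : IsHeavyTailed α M)
    {F : Vel d → ℝ} (hF : ∀ᵐ v, 0 < F v) (hFi : Integrable F) (hF1 : ∫ v, F v = 1) :
    Integrable (collision M σ F) := by
  obtain ⟨ν₁, ν₂, h0, hb⟩ := hσ.bounds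
  have habs : ∀ {k : Vel d → ℝ}, (∀ᵐ v, 0 < k v) → Integrable k → ∫ v, k v = 1 →
      ∀ᵐ v, ‖gainRate σ k v‖ ≤ ν₂ := fun hk hki hk1 => Eventually.of_forall fun v => by
    have := hσ.gainRate_bounds hb hk hki hk1 v
    rw [Real.norm_eq_abs, abs_of_pos (h0.trans_le this.1)]
    exact this.2
  rw [funext (hσ.collision_eq hM.integrable hFi)]
  refine Integrable.sub ?_ (hFi.bdd_mul (hσ.aestronglyMeasurable_gainRate hM.integrable.1)
    (habs (Eventually.of_forall hM.pos) hM.integrable hM.integral_eq_one))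
  simp_rw [mul_comm (M _)]
  exact hM.integrable.bdd_mul (hσ.aestronglyMeasurable_gainRate hFi.1) (habs hF hFi hF1)

/-! ### Lower bound on the modified equilibrium -/

/-- The growth of `M` along segments is at most exponential. -/
theorem IsHeavyTailed.exists_exp_mul_le (hM : IsHeavyTailed α M) :
    ∃ C : ℝ, 0 ≤ C ∧ ∀ v w : Vel d, Real.exp (-(C * ‖w‖)) * M v ≤ M (v + w) := by
  obtain ⟨C, hC⟩ := hM.norm_fderiv_le
  refine ⟨|C|, abs_nonneg C, fun v w => ?_⟩
  have hbd : ∀ x, ‖fderiv ℝ M x‖ ≤ |C| * M x := fun x => by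
    refine (hC x).trans ?_
    have h1 : M x / (1 + ‖x‖) ≤ M x :=
      div_le_self (hM.pos x).le (by linarith [norm_nonneg x])
    exact mul_le_mul (le_abs_self C) h1 (div_nonneg (hM.pos x).le (by positivity)) (abs_nonneg C)
  -- Along the segment M decreases at rate at most K M, so the factor exp(K t) makes the product
  -- monotone.
  set K := |C| * ‖w‖ with hK
  have hder : ∀ t : ℝ, HasDerivAt (fun t : ℝ => Real.exp (K * t) * M (v + t • w))
      (Real.exp (K * t) * K * M (v + t • w) +
        Real.exp (K * t) * fderiv ℝ M (v + t • w) w) t := fun t => by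
    have h1 : HasDerivAt (fun t : ℝ => v + t • w) w t := by
      simpa using ((hasDerivAt_id t).smul_const w).const_add v
    have h2 : HasDerivAt (fun t : ℝ => Real.exp (K * t)) (Real.exp (K * t) * K) t := by
      simpa using ((hasDerivAt_id t).const_mul K).exp
    exact h2.mul ((hM.differentiable _).hasFDerivAt.comp_hasDerivAt t h1)
  have hmono : Monotone (fun t : ℝ => Real.exp (K * t) * M (v + t • w)) := by
    refine monotone_of_hasDerivAt_nonneg hder fun t => ?_
    have h3 : |fderiv ℝ M (v + t • w) w| ≤ K * M (v + t • w) := by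
      refine ((fderiv ℝ M (v + t • w)).le_opNorm w).trans ?_
      refine (mul_le_mul_of_nonneg_right (hbd _) (norm_nonneg w)).trans (le_of_eq ?_)
      rw [hK]; ring
    have h4 := (abs_le.1 h3).1
    have h5 := Real.exp_pos (K * t)
    simp only [Pi.zero_apply]
    nlinarith
  have h := hmono zero_le_one
  simp only [mul_zero, Real.exp_zero, zero_smul, add_zero, one_mul, mul_one, one_smul] at h
  calc Real.exp (-K) * M v ≤ Real.exp (-K) * (Real.exp K * M (v + w)) := by gcongr
    _ = M (v + w) := by rw [← mul_assoc, ← Real.exp_add]; simp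

/-- The modified equilibrium is bounded below by a multiple of `M`. -/
theorem IsModifiedEquilibrium.exists_mul_le (hM : IsHeavyTailed α M) (hσ : IsCrossSection M σ)
    {E : Vel d} {F : Vel d → ℝ} (hF : IsModifiedEquilibrium M σ E F) :
    ∃ κ : ℝ, 0 < κ ∧ ∀ᵐ v, κ * M v ≤ F v := by
  obtain ⟨ν₁, ν₂, h0, hb⟩ := hσ.bounds
  obtain ⟨C, hC0, hC⟩ := hM.exists_exp_mul_le
  have hν₂ : 0 < ν₂ := h0.trans_le ((hb 0 0).1.trans (hb 0 0).2)
  have hMi := hM.integrable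
  have hFi := hF.integrable
  have hGi : Integrable (collision M σ F) :=
    hσ.integrable_collision hM hF.pos hFi hF.integral_eq_one
  have hG : ∀ᵐ v, ν₁ * M v - ν₂ * F v ≤ collision M σ F v := by
    filter_upwards [hF.pos] with v hv
    rw [hσ.collision_eq hMi hFi]
    have h1 := (hσ.gainRate_bounds hb hF.pos hFi hF.integral_eq_one v).1
    have h2 := (hσ.gainRate_bounds hb (Eventually.of_forall hM.pos) hMi hM.integral_eq_one v).2
    nlinarith [mul_le_mul_of_nonneg_left h1 (hM.pos v).le, mul_le_mul_of_nonneg_right h2 hv.le]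
  -- Going back one unit of s costs exp(-ν₂) through the loss term and exp(-C‖E‖) through the
  -- variation of M; ν₁ M bounds the gain term from below.
  set κ := ν₁ * Real.exp (-(ν₂ + C * ‖E‖)) with hκ
  have hκ0 : 0 < κ := by positivity
  refine ⟨κ, hκ0, ae_le_of_forall_setIntegral_le (hMi.const_mul κ) hFi fun S hS _ => ?_⟩
  -- F has no pointwise derivative, so the Gronwall argument is run on the averages of its
  -- translates over an arbitrary measurable set.
  set ψ : Vel d → ℝ := S.indicator 1 with hψ
  have hψm : AEStronglyMeasurable ψ volume :=
    (stronglyMeasurable_one.indicator hS).aestronglyMeasurable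
  have hψ01 : ∀ v, 0 ≤ ψ v ∧ ψ v ≤ 1 := fun v => by
    by_cases hv : v ∈ S <;> simp [hψ, hv]
  have hψ1 : ∀ v, |ψ v| ≤ 1 := fun v => by rw [abs_of_nonneg (hψ01 v).1]; exact (hψ01 v).2
  have hψint : ∀ k : Vel d → ℝ, ∫ v in S, k v = ∫ v, ψ v * k v := fun k => by
    rw [← integral_indicator hS]
    refine integral_congr_ae (Eventually.of_forall fun v => ?_)
    by_cases hv : v ∈ S <;> simp [hψ, hv]
  have hψi : ∀ {k : Vel d → ℝ} (s : ℝ), Integrable k →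
      Integrable (fun v => ψ v * k (v + s • E)) := fun s hk =>
    (hk.comp_add_right (s • E)).bdd_mul hψm (Eventually.of_forall fun v => by simpa using hψ1 v)
  rw [hψint, hψint]
  simp_rw [mul_left_comm (ψ _) κ, integral_const_mul]
  set m := ∫ v, ψ v * M v with hm
  set Φ : ℝ → ℝ := fun s => ∫ v, ψ v * F (v + s • E) with hΦ
  have hder := hasDerivAt_integral_mul_translate hFi hGi hF.equation hψm hψ1
  have hΦ0 : ∀ s, 0 ≤ Φ s := fun s => by
    refine integral_nonneg_of_ae ?_
    filter_upwards [(measurePreserving_add_right volume (s • E)).quasiMeasurePreserving.ae hF.pos]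
      with v hv
    exact mul_nonneg (hψ01 v).1 hv.le
  have hm0 : 0 ≤ m := integral_nonneg fun v => mul_nonneg (hψ01 v).1 (hM.pos v).le
  have hlow : ∀ s ∈ Set.Icc (-1 : ℝ) 0, ν₁ * (Real.exp (-(C * ‖E‖)) * m) - ν₂ * Φ s ≤
      ∫ v, ψ v * collision M σ F (v + s • E) := fun s hs => by
    have hi1 : Integrable (fun v => ν₁ * (Real.exp (-(C * ‖E‖)) * (ψ v * M v))) :=
      ((by simpa using hψi 0 hMi : Integrable fun v => ψ v * M v).const_mul _).const_mul _
    have hi2 : Integrable (fun v => ν₂ * (ψ v * F (v + s • E))) := (hψi s hFi).const_mul _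
    rw [hΦ, hm, ← integral_const_mul, ← integral_const_mul, ← integral_const_mul,
      ← integral_sub hi1 hi2]
    refine integral_mono_ae (hi1.sub hi2)
      (hψi s hGi) ?_
    filter_upwards [(measurePreserving_add_right volume (s • E)).quasiMeasurePreserving.ae hG]
      with v hv
    have h1 := hC v (s • E)
    have h2 : Real.exp (-(C * ‖E‖)) ≤ Real.exp (-(C * ‖s • E‖)) := by
      rw [norm_smul, Real.norm_eq_abs]
      have : |s| ≤ 1 := abs_le.2 ⟨hs.1, hs.2.trans zero_le_one⟩
      have h5 : |s| * ‖E‖ ≤ 1 * ‖E‖ := by gcongr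
      rw [one_mul] at h5
      gcongr
    have h3 : Real.exp (-(C * ‖E‖)) * M v ≤ M (v + s • E) :=
      (mul_le_mul_of_nonneg_right h2 (hM.pos v).le).trans h1
    have h4 := mul_le_mul_of_nonneg_left h3 h0.le
    have h6 : ν₁ * (Real.exp (-(C * ‖E‖)) * M v) - ν₂ * F (v + s • E) ≤
      collision M σ F (v + s • E) := by linarith
    have h7 := mul_le_mul_of_nonneg_left h6 (hψ01 v).1
    linarith
  -- Gronwall with integrating factor exp(ν₂ s). Comparing s = -1 with s = 0 and dropping Φ(-1) ≥ 0
  -- gives Φ(0) ≥ κ m.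
  have hmono : MonotoneOn (fun s => Real.exp (ν₂ * s) * Φ s - κ * m * s) (Set.Icc (-1) 0) := by
    have hd : ∀ s, HasDerivAt (fun s => Real.exp (ν₂ * s) * Φ s - κ * m * s)
        (Real.exp (ν₂ * s) * ν₂ * Φ s + Real.exp (ν₂ * s) *
          (∫ v, ψ v * collision M σ F (v + s • E)) - κ * m) s := fun s => by
      have h2 : HasDerivAt (fun t : ℝ => Real.exp (ν₂ * t)) (Real.exp (ν₂ * s) * ν₂) s := by
        simpa using ((hasDerivAt_id s).const_mul ν₂).exp
      have h3 : HasDerivAt (fun t : ℝ => κ * m * t) (κ * m) s := by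
        simpa using (hasDerivAt_id s).const_mul (κ * m)
      exact (h2.mul (hder s)).sub h3
    refine monotoneOn_of_hasDerivWithinAt_nonneg (convex_Icc _ _)
      (fun s _ => (hd s).continuousAt.continuousWithinAt)
      (fun s _ => (hd s).hasDerivWithinAt) fun s hs => ?_
    rw [interior_Icc] at hs
    have h1 := hlow s ⟨hs.1.le, hs.2.le⟩
    have h2 := mul_le_mul_of_nonneg_left h1 (Real.exp_pos (ν₂ * s)).le
    have h3 : Real.exp (-ν₂) ≤ Real.exp (ν₂ * s) := Real.exp_le_exp.2 (by nlinarith [hs.1])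
    have h4 : κ * m = Real.exp (-ν₂) * (ν₁ * (Real.exp (-(C * ‖E‖)) * m)) := by
      rw [hκ, neg_add, Real.exp_add]; ring
    have h5 : 0 ≤ ν₁ * (Real.exp (-(C * ‖E‖)) * m) := by positivity
    rw [h4]
    nlinarith [mul_le_mul_of_nonneg_right h3 h5]
  have hfin := hmono (Set.left_mem_Icc.2 (by norm_num)) (Set.right_mem_Icc.2 (by norm_num))
    (by norm_num : (-1 : ℝ) ≤ 0)
  have hpos := mul_nonneg (Real.exp_pos (ν₂ * (-1))).le (hΦ0 (-1))
  have hz : Φ 0 = ∫ v, ψ v * F v := by simp [hΦ]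
  rw [← hz]
  simp only [mul_zero, Real.exp_zero, one_mul, sub_zero] at hfin
  linarith

/-! ### The transport term -/

/-- Lets the chosen `weakDirDeriv` inherit the weighted integrability of the derivative supplied by
`InDomain`. -/
theorem HasWeakDirDeriv.ae_eq {E : Vel d} {f g g' : Vel d → ℝ} (h : HasWeakDirDeriv E f g)
    (h' : HasWeakDirDeriv E f g') : g =ᵐ[volume] g' := by
  refine ae_eq_of_integral_contDiff_smul_eq h.2.1 h'.2.1 fun φ hφ hφc => ?_
  have := (h.2.2 φ hφ hφc).symm.trans (h'.2.2 φ hφ hφc)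
  simpa [mul_comm] using this

theorem HasWeakDirDeriv.weakDirDeriv {E : Vel d} {f g : Vel d → ℝ}
    (h : HasWeakDirDeriv E f g) : HasWeakDirDeriv E f (weakDirDeriv E f) := by
  have hex : ∃ g, HasWeakDirDeriv E f g := ⟨g, h⟩
  rw [LinearBoltzmann.weakDirDeriv, dif_pos hex]
  exact hex.choose_spec

/-- Truncation to `[-n, n]`. -/
noncomputable def truncate (n x : ℝ) : ℝ := max (-n) (min x n)

theorem continuous_truncate (n : ℝ) : Continuous (truncate n) := by
  unfold truncate; fun_prop

theorem abs_truncate_le {n : ℝ} (hn : 0 ≤ n) (x : ℝ) : |truncate n x| ≤ n :=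
  abs_le.2 ⟨le_max_left _ _, max_le (by linarith) (min_le_right _ _)⟩

theorem abs_truncate_le_abs {n : ℝ} (hn : 0 ≤ n) (x : ℝ) : |truncate n x| ≤ |x| := by
  refine abs_le.2 ⟨?_, max_le (by linarith [abs_nonneg x]) ((min_le_left _ _).trans (le_abs_self x))⟩
  unfold truncate
  rcases le_total x n with h | h
  · rw [min_eq_left h]; exact (neg_abs_le x).trans (le_max_right _ _)
  · rw [min_eq_right h]; exact (by linarith [abs_nonneg x] : -|x| ≤ n).trans (le_max_right _ _)

theorem truncate_eq_self {n x : ℝ} (h : |x| ≤ n) : truncate n x = x := by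
  rw [truncate, min_eq_left (abs_le.1 h).2, max_eq_right (abs_le.1 h).1]

/-- Among `|a| ≤ n`, the quadratic `2 a x - a²` is largest at the truncation of `x`. -/
theorem two_mul_sub_sq_le_truncate {n a : ℝ} (x : ℝ) (ha : |a| ≤ n) :
    2 * a * x - a ^ 2 ≤ 2 * truncate n x * x - truncate n x ^ 2 := by
  obtain ⟨h1, h2⟩ := abs_le.1 ha
  unfold truncate
  rcases le_total x n with h | h
  · rw [min_eq_left h]
    rcases le_total (-n) x with h' | h'
    · rw [max_eq_right h']; nlinarith [sq_nonneg (a - x)]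
    · rw [max_eq_left h']; nlinarith
  · rw [min_eq_right h, max_eq_right (by linarith)]; nlinarith

variable {E : Vel d} {f g F G : Vel d → ℝ}

theorem aestronglyMeasurable_truncate_div (hf : AEStronglyMeasurable f volume)
    (hF : AEStronglyMeasurable F volume) (n : ℝ) :
    AEStronglyMeasurable (fun v => truncate n (f v / F v)) volume :=
  (continuous_truncate n).comp_aestronglyMeasurable
    (hf.aemeasurable.div hF.aemeasurable).aestronglyMeasurable

/-- A substitute for the chain rule. Freeze c = truncate n (f/F) and translate only f and F in ∫ (2
c f - c² F). By optimality of the truncation among values in [-n, n], this function of s is maximal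
at s = 0, so its derivative there, which is the stated integral, vanishes. Truncation keeps c
bounded, hence admissible against L¹ derivatives. -/
theorem integral_truncate_transport_eq_zero (hfi : Integrable f) (hgi : Integrable g)
    (hfg : HasWeakDirDeriv E f g) (hFi : Integrable F) (hGi : Integrable G)
    (hFG : HasWeakDirDeriv E F G) (hF : ∀ᵐ v, 0 < F v) {n : ℝ} (hn : 0 ≤ n) :
    ∫ v, (2 * truncate n (f v / F v) * g v - truncate n (f v / F v) ^ 2 * G v) = 0 := by
  set c : Vel d → ℝ := fun v => truncate n (f v / F v) with hc
  have hcm : AEStronglyMeasurable c volume := aestronglyMeasurable_truncate_div hfi.1 hFi.1 n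
  have hcn : ∀ v, |c v| ≤ n := fun v => abs_truncate_le hn _
  have hm1 : AEStronglyMeasurable (fun v => 2 * c v) volume := hcm.const_mul 2
  have hb1 : ∀ v, |2 * c v| ≤ 2 * n := fun v => by
    rw [abs_mul, abs_two]; linarith [hcn v]
  have hm2 : AEStronglyMeasurable (fun v => c v ^ 2) volume := hcm.pow 2
  have hb2 : ∀ v, |c v ^ 2| ≤ n ^ 2 := fun v => by
    rw [abs_pow]; exact pow_le_pow_left₀ (abs_nonneg _) (hcn v) 2
  have hi1 : ∀ {k : Vel d → ℝ} (s : ℝ), Integrable k →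
      Integrable (fun v => 2 * c v * k (v + s • E)) := fun s hk =>
    (hk.comp_add_right (s • E)).bdd_mul hm1 (Eventually.of_forall hb1)
  have hi2 : ∀ {k : Vel d → ℝ} (s : ℝ), Integrable k →
      Integrable (fun v => c v ^ 2 * k (v + s • E)) := fun s hk =>
    (hk.comp_add_right (s • E)).bdd_mul hm2 (Eventually.of_forall hb2)
  set Ψ : ℝ → ℝ := fun s => (∫ v, 2 * c v * f (v + s • E)) - ∫ v, c v ^ 2 * F (v + s • E) with hΨ
  have hder : HasDerivAt Ψ ((∫ v, 2 * c v * g (v + (0 : ℝ) • E)) -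
      ∫ v, c v ^ 2 * G (v + (0 : ℝ) • E)) 0 :=
    (hasDerivAt_integral_mul_translate hfi hgi hfg hm1 hb1 0).sub
      (hasDerivAt_integral_mul_translate hFi hGi hFG hm2 hb2 0)
  have hmax : ∀ s, Ψ s ≤ Ψ 0 := fun s => by
    -- Translating the whole integrand leaves Ψ 0 unchanged. At each point v + sE the frozen value
    -- c(v) then competes with the optimal value c(v + sE).
    have h0 : Ψ 0 = ∫ v, (2 * c (v + s • E) * f (v + s • E) -
        c (v + s • E) ^ 2 * F (v + s • E)) := by
      rw [integral_add_right_eq_self (fun v => 2 * c v * f v - c v ^ 2 * F v) (s • E),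
        integral_sub (by simpa using hi1 0 hfi) (by simpa using hi2 0 hFi)]
      simp [hΨ]
    have hint : Integrable (fun v => 2 * c v * f v - c v ^ 2 * F v) := by
      have h1 := (hi1 0 hfi).sub (hi2 0 hFi)
      simp only [zero_smul, add_zero] at h1
      exact h1
    rw [h0, hΨ]
    beta_reduce
    rw [← integral_sub (hi1 s hfi) (hi2 s hFi)]
    refine integral_mono_ae ((hi1 s hfi).sub (hi2 s hFi)) (hint.comp_add_right (s • E)) ?_
    filter_upwards [(measurePreserving_add_right volume (s • E)).quasiMeasurePreserving.ae hF]
      with v hv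
    have h1 := mul_le_mul_of_nonneg_left
      (two_mul_sub_sq_le_truncate (f (v + s • E) / F (v + s • E)) (hcn v)) hv.le
    have h2 : ∀ a : ℝ, F (v + s • E) * (2 * a * (f (v + s • E) / F (v + s • E)) - a ^ 2) =
        2 * a * f (v + s • E) - a ^ 2 * F (v + s • E) := fun a => by
      field_simp
    rw [h2, h2] at h1
    exact h1
  have hz := IsLocalMax.hasDerivAt_eq_zero (Eventually.of_forall hmax) hder
  simp only [zero_smul, add_zero] at hz
  rw [integral_sub (by simpa using hi1 0 hgi) (by simpa using hi2 0 hGi)]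
  exact hz

/-- Integration by parts: `∫ (E · ∇f) f / F = ½ ∫ (E · ∇F) (f / F)²`. -/
theorem two_mul_integral_transport (hfi : Integrable f) (hgi : Integrable g)
    (hfg : HasWeakDirDeriv E f g) (hFi : Integrable F) (hGi : Integrable G)
    (hFG : HasWeakDirDeriv E F G) (hF : ∀ᵐ v, 0 < F v)
    (h1 : Integrable (fun v => g v * (f v / F v)))
    (h2 : Integrable (fun v => (f v / F v) ^ 2 * G v)) :
    2 * ∫ v, g v * (f v / F v) = ∫ v, (f v / F v) ^ 2 * G v := by
  -- Since |truncate n x| ≤ |x|, the untruncated integrands dominate; at each point the sequence is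
  -- eventually constant.
  have hlim : Tendsto (fun n : ℕ => ∫ v, (2 * truncate n (f v / F v) * g v -
      truncate n (f v / F v) ^ 2 * G v)) atTop
      (𝓝 (∫ v, (2 * (g v * (f v / F v)) - (f v / F v) ^ 2 * G v))) := by
    refine tendsto_integral_of_dominated_convergence
      (fun v => 2 * |g v * (f v / F v)| + |(f v / F v) ^ 2 * G v|) (fun n => ?_)
      ((h1.abs.const_mul 2).add h2.abs) (fun n => Eventually.of_forall fun v => ?_)
      (Eventually.of_forall fun v => ?_)
    · have hm := aestronglyMeasurable_truncate_div hfi.1 hFi.1 n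
      exact ((hm.const_mul 2).mul hgi.1).sub ((hm.pow 2).mul hGi.1)
    · have ht := abs_truncate_le_abs (Nat.cast_nonneg n) (f v / F v)
      rw [Real.norm_eq_abs]
      refine (abs_sub _ _).trans (add_le_add ?_ ?_)
      · rw [abs_mul, abs_mul, abs_two, abs_mul, mul_assoc, mul_comm |g v|]
        gcongr
      · rw [abs_mul, abs_mul, abs_pow, abs_pow]
        gcongr
    · refine tendsto_const_nhds.congr' ?_
      obtain ⟨N, hN⟩ := exists_nat_ge |f v / F v|
      filter_upwards [eventually_ge_atTop N] with n hn
      rw [truncate_eq_self (hN.trans (Nat.cast_le.2 hn))]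
      ring
  simp_rw [fun n : ℕ => integral_truncate_transport_eq_zero hfi hgi hfg hFi hGi hFG hF
    (Nat.cast_nonneg n)] at hlim
  have h := tendsto_nhds_unique hlim tendsto_const_nhds
  rw [integral_sub (h1.const_mul 2) h2, integral_const_mul] at h
  linarith

/-! ### The collision term -/

theorem IsCrossSection.integrable_kernel (hσ : IsCrossSection M σ) {a b : Vel d → ℝ}
    (ha : Integrable a) (hb : Integrable b) :
    Integrable (fun p : Vel d × Vel d => σ p.1 p.2 * (a p.1 * b p.2)) (volume.prod volume) := by
  obtain ⟨ν₁, ν₂, h0, hbd⟩ := hσ.bounds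
  refine (ha.mul_prod hb).bdd_mul (c := ν₂) hσ.stronglyMeasurable.aestronglyMeasurable
    (Eventually.of_forall fun p => ?_)
  rw [Real.norm_eq_abs, abs_of_pos (h0.trans_le (hbd _ _).1)]
  exact (hbd _ _).2

theorem IsCrossSection.integrable_mul_gainRate (hσ : IsCrossSection M σ) {a b : Vel d → ℝ}
    (ha : Integrable a) (hb : Integrable b) : Integrable (fun v => a v * gainRate σ b v) := by
  refine (hσ.integrable_kernel ha hb).integral_prod_left.congr
    (Eventually.of_forall fun v => ?_)
  simp only [gainRate, mul_left_comm (σ _ _), integral_const_mul]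

theorem IsCrossSection.integral_kernel (hσ : IsCrossSection M σ) {a b : Vel d → ℝ}
    (ha : Integrable a) (hb : Integrable b) :
    ∫ p : Vel d × Vel d, σ p.1 p.2 * (a p.1 * b p.2) ∂(volume.prod volume) =
      ∫ v, a v * gainRate σ b v := by
  rw [integral_prod _ (hσ.integrable_kernel ha hb)]
  simp only [gainRate, mul_left_comm (σ _ _), integral_const_mul]

theorem IsCrossSection.integral_kernel_symm (hσ : IsCrossSection M σ) {a b : Vel d → ℝ}
    (ha : Integrable a) (hb : Integrable b) :
    ∫ p : Vel d × Vel d, σ p.1 p.2 * (a p.1 * b p.2) ∂(volume.prod volume) =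
      ∫ v, b v * gainRate σ a v := by
  rw [← hσ.integral_kernel hb ha, ← integral_prod_swap]
  refine integral_congr_ae (Eventually.of_forall fun p => ?_)
  simp only [Prod.fst_swap, Prod.snd_swap, hσ.symm p.2 p.1, mul_comm]

/-- Coercivity of the quadratic form of the collision operator. -/
theorem IsCrossSection.coercive (hσ : IsCrossSection M σ) {ν₁ : ℝ} (hν₁ : 0 ≤ ν₁)
    (hb : ∀ v v', ν₁ ≤ σ v v') (hM : ∀ v, 0 < M v) (hMi : Integrable M) (hM1 : ∫ v, M v = 1)
    (hF : ∀ᵐ v, 0 < F v) (hFi : Integrable F) (hF1 : ∫ v, F v = 1) {h : Vel d → ℝ}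
    (hfh : ∀ᵐ v, f v = F v * h v) (hfi : Integrable f) (hMh : Integrable (fun v => M v * h v))
    (hMh2 : Integrable (fun v => M v * h v ^ 2)) (hFh2 : Integrable (fun v => F v * h v ^ 2)) :
    ν₁ * ((∫ v, F v * h v ^ 2) - (∫ v, f v) ^ 2) ≤
      (∫ v, M v * h v ^ 2 * gainRate σ F v) + (∫ v, F v * h v ^ 2 * gainRate σ M v) -
        2 * ∫ v, M v * h v * gainRate σ f v := by
  have k1 := hσ.integrable_kernel hMh2 hFi
  have k2 := hσ.integrable_kernel hMi hFh2
  have k3 := (hσ.integrable_kernel hMh hfi).const_mul 2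
  have k12 : Integrable (fun p : Vel d × Vel d => σ p.1 p.2 * (M p.1 * h p.1 ^ 2 * F p.2) +
    σ p.1 p.2 * (M p.1 * (F p.2 * h p.2 ^ 2))) (volume.prod volume) := k1.add k2
  -- The middle term is written with the variables exchanged, so that all three share the weight σ
  -- M(v) F(v') and assemble into (h(v) - h(v'))².
  rw [← hσ.integral_kernel hMh2 hFi, ← hσ.integral_kernel_symm hMi hFh2,
    ← hσ.integral_kernel hMh hfi, ← integral_const_mul,
    ← integral_add k1 k2, ← integral_sub k12 k3]
  have j1 := hMh2.mul_prod hFi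
  have j2 := hMi.mul_prod hFh2
  have j3 := hMh.mul_prod hfi
  have j12 : Integrable (fun p : Vel d × Vel d => M p.1 * h p.1 ^ 2 * F p.2 +
    M p.1 * (F p.2 * h p.2 ^ 2)) (volume.prod volume) := j1.add j2
  have hlow : ∫ p : Vel d × Vel d, ν₁ * ((M p.1 * h p.1 ^ 2) * F p.2 + M p.1 * (F p.2 * h p.2 ^ 2)
        - 2 * ((M p.1 * h p.1) * f p.2)) ∂(volume.prod volume) =
      ν₁ * ((∫ v, M v * h v ^ 2) + (∫ v, F v * h v ^ 2) -
        2 * ((∫ v, M v * h v) * ∫ v, f v)) := by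
    rw [integral_const_mul, integral_sub j12 (j3.const_mul 2), integral_add j1 j2,
      integral_const_mul, integral_prod_mul (fun v => M v * h v ^ 2) F,
      integral_prod_mul M (fun v => F v * h v ^ 2), integral_prod_mul (fun v => M v * h v) f,
      hM1, hF1, mul_one, one_mul]
  set m := ∫ v, M v * h v with hm
  -- The variance of h under M dv is nonnegative.
  have hJ : m ^ 2 ≤ ∫ v, M v * h v ^ 2 := by
    have h1 : 0 ≤ ∫ v, M v * (h v - m) ^ 2 :=
      integral_nonneg fun v => mul_nonneg (hM v).le (sq_nonneg _)
    have h2 : ∫ v, M v * (h v - m) ^ 2 =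
        ∫ v, (M v * h v ^ 2 - 2 * m * (M v * h v) + m ^ 2 * M v) :=
      integral_congr_ae (Eventually.of_forall fun v => by ring)
    have h3 : Integrable (fun v => M v * h v ^ 2 - 2 * m * (M v * h v)) :=
      hMh2.sub (hMh.const_mul _)
    rw [h2, integral_add h3 (hMi.const_mul _),
      integral_sub hMh2 (hMh.const_mul _), integral_const_mul, integral_const_mul, hM1] at h1
    nlinarith
  -- With ρ = ∫ f: ∫ M h² - 2 m ρ ≥ m² - 2 m ρ ≥ -ρ².
  have hle : ν₁ * ((∫ v, F v * h v ^ 2) - (∫ v, f v) ^ 2) ≤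
      ν₁ * ((∫ v, M v * h v ^ 2) + (∫ v, F v * h v ^ 2) - 2 * (m * ∫ v, f v)) :=
    mul_le_mul_of_nonneg_left (by nlinarith [sq_nonneg (m - ∫ v, f v)]) hν₁
  refine hle.trans (hlow ▸ integral_mono_ae ((j12.sub (j3.const_mul 2)).const_mul ν₁)
    (k12.sub k3) ?_)
  filter_upwards [Measure.quasiMeasurePreserving_snd.ae hF,
    Measure.quasiMeasurePreserving_snd.ae hfh] with p hp1 hp2
  have h1 : 0 ≤ M p.1 * F p.2 * (h p.1 - h p.2) ^ 2 :=
    mul_nonneg (mul_nonneg (hM _).le hp1.le) (sq_nonneg _)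
  have h2 := mul_le_mul_of_nonneg_right (hb p.1 p.2) h1
  rw [hp2]
  linarith

/-! ### Coercivity of the transport-collision operator -/

/-- This is the variance formula for f/F under the probability density F, whose mean is ρ_f. -/
theorem IsModifiedEquilibrium.integral_sub_mean (hF : IsModifiedEquilibrium M σ E F)
    (hf : MemL2Inv F f) :
    MemL2Inv F (fun v => f v - massDensity f * F v) ∧
      normL2Inv F (fun v => f v - massDensity f * F v) ^ 2 =
        (∫ v, F v * (f v / F v) ^ 2) - (∫ v, f v) ^ 2 := by
  have hFi := hF.integrable
  have hfi := hf.integrable hF.pos hFi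
  set ρ := massDensity f with hρ
  have hFh2 : Integrable (fun v => F v * (f v / F v) ^ 2) := hf.2.congr (by
    filter_upwards [hF.pos] with v hv
    rw [sq_abs]
    field_simp)
  have hae : (fun v => |f v - ρ * F v| ^ 2 / F v) =ᵐ[volume]
      fun v => F v * (f v / F v) ^ 2 - 2 * ρ * f v + ρ ^ 2 * F v := by
    filter_upwards [hF.pos] with v hv
    rw [sq_abs]
    field_simp
    ring
  have hsub : Integrable (fun v => F v * (f v / F v) ^ 2 - 2 * ρ * f v) :=
    hFh2.sub (hfi.const_mul _)
  have hint : Integrable (fun v => F v * (f v / F v) ^ 2 - 2 * ρ * f v + ρ ^ 2 * F v) :=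
    hsub.add (hFi.const_mul _)
  refine ⟨⟨hfi.1.sub (hFi.1.const_mul ρ), hint.congr hae.symm⟩, ?_⟩
  rw [normL2Inv, Real.sq_sqrt (integral_nonneg_of_ae (by
    filter_upwards [hF.pos] with v hv
    exact div_nonneg (by positivity) hv.le)), integral_congr_ae hae,
    integral_add hsub (hFi.const_mul _),
    integral_sub hFh2 (hfi.const_mul _), integral_const_mul, integral_const_mul,
    hF.integral_eq_one, hρ, massDensity]
  ring

/-- The transport identity with E·∇F = Q(F) supplies half of ∫ M h² A_F - ∫ F h² A_M, where A
denotes `gainRate`. Added to the collision term, it gives exactly half the quadratic form of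
`IsCrossSection.coercive`, hence the factor ν₁/2. -/
theorem transportCollision_coercive (hM : IsHeavyTailed α M) (hσ : IsCrossSection M σ)
    {ν₁ : ℝ} (hν₁ : 0 ≤ ν₁) (hb : ∀ v v', ν₁ ≤ σ v v') (hF : IsModifiedEquilibrium M σ E F)
    (hf : InDomain M E f) :
    Integrable (fun v => transportCollision M σ E f v * (f v / F v)) ∧ MemL2Inv F f ∧
      ν₁ / 2 * ((∫ v, F v * (f v / F v) ^ 2) - (∫ v, f v) ^ 2) ≤
        ∫ v, transportCollision M σ E f v * (f v / F v) := by
  obtain ⟨hfM, g₀, hfg₀, hg₀M⟩ := hf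
  obtain ⟨κ, hκ, hκF⟩ := hF.exists_mul_le hM hσ
  have hMpos : ∀ᵐ v, 0 < M v := Eventually.of_forall hM.pos
  have hMi := hM.integrable
  have hFi := hF.integrable
  have hGi := hσ.integrable_collision hM hF.pos hFi hF.integral_eq_one
  have hfg := hfg₀.weakDirDeriv
  set g := weakDirDeriv E f with hg
  have hgM : MemL2Inv M g := by
    have hae := hfg₀.ae_eq hfg
    exact ⟨hg₀M.1.congr hae, hg₀M.2.congr (hae.mono fun v hv => by simp only [hv])⟩
  have hfi := hfM.integrable hMpos hMi
  have hgi := hgM.integrable hMpos hMi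
  have hfF := hfM.of_mul_le hκ hMpos hFi.1 hκF
  have hgF := hgM.of_mul_le hκ hMpos hFi.1 hκF
  set h : Vel d → ℝ := fun v => f v / F v with hh
  have hhm : AEStronglyMeasurable h volume :=
    (hfi.1.aemeasurable.div hFi.1.aemeasurable).aestronglyMeasurable
  have hfh : ∀ᵐ v, f v = F v * h v := by
    filter_upwards [hF.pos] with v hv
    rw [hh]; field_simp
  have hFh2 : Integrable (fun v => F v * h v ^ 2) := hfF.2.congr (by
    filter_upwards [hF.pos] with v hv
    rw [sq_abs, hh]
    field_simp)
  -- Here M ≤ κ⁻¹ F is essential: it makes the gain part of h² Q(F) integrable.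
  have hMh2 : Integrable (fun v => M v * h v ^ 2) := by
    refine (hFh2.const_mul κ⁻¹).mono' (hMi.1.mul (hhm.pow 2)) ?_
    filter_upwards [hκF] with v hv
    rw [Real.norm_eq_abs, abs_of_nonneg (mul_nonneg (hM.pos v).le (sq_nonneg _)), ← mul_assoc]
    refine mul_le_mul_of_nonneg_right ?_ (sq_nonneg _)
    rw [inv_mul_eq_div, le_div_iff₀ hκ]
    linarith
  have hMh : Integrable (fun v => M v * h v) := by
    refine (hMi.add hMh2).mono' (hMi.1.mul hhm) (Eventually.of_forall fun v => ?_)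
    rw [Real.norm_eq_abs, abs_mul, abs_of_pos (hM.pos v), Pi.add_apply, ← mul_one_add]
    refine mul_le_mul_of_nonneg_left ?_ (hM.pos v).le
    nlinarith [sq_nonneg (|h v| - 1), sq_abs (h v), abs_nonneg (h v)]
  have hgh : Integrable (fun v => g v * h v) :=
    (hgF.integrable_mul_div hF.pos hFi.1 hfF).congr
      (Eventually.of_forall fun v => mul_div_assoc _ _ _)
  have i1 := hσ.integrable_mul_gainRate hMh2 hFi
  have i2 := hσ.integrable_mul_gainRate hFh2 hMi
  have i3 := hσ.integrable_mul_gainRate hMh hfi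
  have hG : ∀ v, h v ^ 2 * collision M σ F v =
      M v * h v ^ 2 * gainRate σ F v - F v * h v ^ 2 * gainRate σ M v := fun v => by
    rw [hσ.collision_eq hMi hFi]; ring
  have htr := two_mul_integral_transport hfi hgi hfg hFi hGi hF.equation hF.pos hgh
    ((i1.sub i2).congr (Eventually.of_forall fun v => (hG v).symm))
  have htr' : 2 * ∫ v, g v * h v = (∫ v, M v * h v ^ 2 * gainRate σ F v) -
      ∫ v, F v * h v ^ 2 * gainRate σ M v := by
    rw [← integral_sub i1 i2, htr]
    exact integral_congr_ae (Eventually.of_forall hG)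
  have hT : (fun v => transportCollision M σ E f v * h v) =ᵐ[volume]
      fun v => F v * h v ^ 2 * gainRate σ M v - M v * h v * gainRate σ f v + g v * h v := by
    filter_upwards [hfh] with v hv
    rw [transportCollision, ← hg, hσ.collision_eq hMi hfi]
    have : gainRate σ M v * f v = gainRate σ M v * (F v * h v) := by rw [← hv]
    linear_combination h v * this
  have i23 : Integrable (fun v => F v * h v ^ 2 * gainRate σ M v - M v * h v * gainRate σ f v) :=
    i2.sub i3
  refine ⟨(i23.add hgh).congr hT.symm, hfF, ?_⟩
  rw [integral_congr_ae hT, integral_add i23 hgh, integral_sub i2 i3]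
  have hco := hσ.coercive hν₁ hb hM.pos hMi hM.integral_eq_one hF.pos hFi hF.integral_eq_one hfh
    hfi hMh hMh2 hFh2
  linarith

end LinearBoltzmann

theorem proposition2p9 {d : ℕ} (α : ℝ)
    (M : LinearBoltzmann.Vel d → ℝ)
    (σ : LinearBoltzmann.Vel d → LinearBoltzmann.Vel d → ℝ)
    (hM : LinearBoltzmann.IsHeavyTailed α M)
    (hσ : LinearBoltzmann.IsCrossSection M σ) :
    (∀ (E : LinearBoltzmann.Vel d) (F : LinearBoltzmann.Vel d → ℝ),
      LinearBoltzmann.IsModifiedEquilibrium M σ E F →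
      ∀ f : LinearBoltzmann.Vel d → ℝ, LinearBoltzmann.InDomain M E f →
        Integrable
          (fun v => LinearBoltzmann.transportCollision M σ E f v * (f v / F v)) volume ∧
        0 ≤ ∫ v, LinearBoltzmann.transportCollision M σ E f v * (f v / F v)) ∧
    (∀ R : ℝ, 0 < R → ∃ θ : ℝ, 0 < θ ∧
      ∀ E : LinearBoltzmann.Vel d, ‖E‖ ≤ R →
      ∀ F : LinearBoltzmann.Vel d → ℝ, LinearBoltzmann.IsModifiedEquilibrium M σ E F →
      ∀ f : LinearBoltzmann.Vel d → ℝ, LinearBoltzmann.InDomain M E f →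
        LinearBoltzmann.MemL2Inv F f ∧
        LinearBoltzmann.MemL2Inv F (fun v => f v - LinearBoltzmann.massDensity f * F v) ∧
        θ * LinearBoltzmann.normL2Inv F
              (fun v => f v - LinearBoltzmann.massDensity f * F v) ^ 2 ≤
          ∫ v, LinearBoltzmann.transportCollision M σ E f v * (f v / F v)) := by
  obtain ⟨ν₁, ν₂, h0, hb⟩ := hσ.bounds
  have hb1 : ∀ v v', ν₁ ≤ σ v v' := fun v v' => (hb v v').1
  -- The constant ν₁/2 comes from the lower bound on σ alone, so it serves for every R.
  refine ⟨fun E F hF f hf => ?_, fun R _ => ⟨ν₁ / 2, half_pos h0, fun E _ F hF f hf => ?_⟩⟩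
  · obtain ⟨hi, hfF, hle⟩ := LinearBoltzmann.transportCollision_coercive hM hσ h0.le hb1 hF hf
    refine ⟨hi, le_trans ?_ hle⟩
    rw [← (hF.integral_sub_mean hfF).2]
    positivity
  · obtain ⟨-, hfF, hle⟩ := LinearBoltzmann.transportCollision_coercive hM hσ h0.le hb1 hF hf
    obtain ⟨hmem, hnorm⟩ := hF.integral_sub_mean hfF
    exact ⟨hfF, hmem, hnorm ▸ hle⟩
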